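/- Let $H$ be a complex Hilbert space and let $T$ be a bounded linear operator on $H$, with null space $N(T)$ and range $R(T)$, such that $N(T)=N(T^*)$. Let $T^\dagger$ be the Moore--Penrose inverse of $T$, i.e. the linear operator with domain $D(T^\dagger)=R(T)\oplus R(T)^\perp$ that assigns to each $y\in D(T^\dagger)$ the unique least square solution of minimal norm of the equation $Tx=y$. (A vector $u$ is a least square solution if $\|Tu-y\|\le\|Tx-y\|$ for all $x\in H$.) Then: 1. $T$ is paranormal if and only if $T^\dagger$ is paranormal. Here an operator $S$ with domain $D(S)\subseteq H$ is paranormal if $\|Sx\|^2\le\|S^2x\|$ for all unit vectors $x\in D(S^2)=\{x\in D(S): Sx\in D(S)\}$; for a bounded operator on $H$ this means $\|Sx\|^2\le\|S^2x\|$ for all unit vectors $x\in H$. 2. $T$ is absolutely minimum attaining ($\mathcal{AM}$) if and only if $R(T)$ is closed and $T^\dagger$ is a bounded operator defined on all of $H$ that is absolutely norm attaining ($\mathcal{AN}$). Here a bounded operator $S$ on $H$ is $\mathcal{AN}$ (respectively $\mathcal{AM}$) if for every nonzero closed subspace $M\subseteq H$ there is a unit vector $x\in M$ with $\|Sx\|=\|S|_M\|$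 (respectively $\|Sx\|=\inf\{\|Sz\|: z\in M,\ \|z\|=1\}$). -/

import Mathlib

noncomputable section

namespace HilbertOperator

variable {H₁ H₂ H : Type*}
  [NormedAddCommGroup H₁] [InnerProductSpace ℂ H₁]
  [NormedAddCommGroup H₂] [InnerProductSpace ℂ H₂]
  [NormedAddCommGroup H] [InnerProductSpace ℂ H]

/-- `T` is norm attaining: `‖T x‖ = ‖T‖` for some unit vector `x`. -/
def NormAttaining (T : H₁ →L[ℂ] H₂) : Prop :=
  ∃ x : H₁, ‖x‖ = 1 ∧ ‖T x‖ = ‖T‖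

/-- `T` is absolutely norm attaining: its restriction to every nonzero closed subspace is norm
attaining. (The zero subspace has no unit vector and has to be left out.) -/
def AbsolutelyNormAttaining (T : H₁ →L[ℂ] H₂) : Prop :=
  ∀ M : Submodule ℂ H₁, IsClosed (M : Set H₁) → M ≠ ⊥ → NormAttaining (T ∘L M.subtypeL)

/-- The minimum modulus `m(T) = inf {‖T x‖ : ‖x‖ = 1}`. -/
def minimumModulus (T : H₁ →L[ℂ] H₂) : ℝ :=
  sInf {r : ℝ | ∃ x : H₁, ‖x‖ = 1 ∧ ‖T x‖ = r}

/-- `T` is minimum attaining: `‖T x‖ = m(T)` for some unit vector `x`. -/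
def MinimumAttaining (T : H₁ →L[ℂ] H₂) : Prop :=
  ∃ x : H₁, ‖x‖ = 1 ∧ ‖T x‖ = minimumModulus T

/-- `T` is absolutely minimum attaining: its restriction to every nonzero closed subspace is
minimum attaining. -/
def AbsolutelyMinimumAttaining (T : H₁ →L[ℂ] H₂) : Prop :=
  ∀ M : Submodule ℂ H₁, IsClosed (M : Set H₁) → M ≠ ⊥ → MinimumAttaining (T ∘L M.subtypeL)

/-- A bounded operator `T` is paranormal: `‖T x‖² ≤ ‖T² x‖` for all unit vectors `x`. -/
def Paranormal (T : H →L[ℂ] H) : Prop :=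
  ∀ x : H, ‖x‖ = 1 → ‖T x‖ ^ 2 ≤ ‖T (T x)‖

/-- A (possibly unbounded) operator `S` with domain `D(S)` is paranormal: `‖S x‖² ≤ ‖S² x‖` for
all unit vectors `x` in `D(S²) = {x ∈ D(S) : S x ∈ D(S)}`. -/
def ParanormalPMap (S : H →ₗ.[ℂ] H) : Prop :=
  ∀ (x : S.domain) (hx : S x ∈ S.domain), ‖(x : H)‖ = 1 → ‖S x‖ ^ 2 ≤ ‖S ⟨S x, hx⟩‖

/-- A bounded operator, regarded as an operator with domain the whole space. -/
def toPMap (T : H₁ →L[ℂ] H₂) : H₁ →ₗ.[ℂ] H₂ :=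
  LinearMap.toPMap (T : H₁ →ₗ[ℂ] H₂) ⊤

/-- For bounded operators the two notions of paranormality agree. -/
theorem paranormalPMap_toPMap (T : H →L[ℂ] H) : ParanormalPMap (toPMap T) ↔ Paranormal T := by
  constructor
  · intro h x hx
    exact h ⟨x, Submodule.mem_top⟩ Submodule.mem_top hx
  · intro h x _ hx
    exact h x hx

/-- `u` is a least square solution of `T x = y`. -/
def IsLeastSquareSolution (T : H₁ →L[ℂ] H₂) (y : H₂) (u : H₁) : Prop :=
  ∀ x : H₁, ‖T u - y‖ ≤ ‖T x - y‖

/-- `u` is a least square solution of minimal norm of `T x = y`. -/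
def IsMinimalLeastSquareSolution (T : H₁ →L[ℂ] H₂) (y : H₂) (u : H₁) : Prop :=
  IsLeastSquareSolution T y u ∧ ∀ v : H₁, IsLeastSquareSolution T y v → ‖u‖ ≤ ‖v‖

/-- The range of `T`. -/
abbrev range (T : H₁ →L[ℂ] H₂) : Submodule ℂ H₂ := LinearMap.range (T : H₁ →ₗ[ℂ] H₂)

/-- The null space of `T`. -/
abbrev nullSpace (T : H₁ →L[ℂ] H₂) : Submodule ℂ H₁ := LinearMap.ker (T : H₁ →ₗ[ℂ] H₂)

theorem forall_norm_sub_le_iff (K : Submodule ℂ H) {u v : H} (hv : v ∈ K) :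
    (∀ w ∈ K, ‖u - v‖ ≤ ‖u - w‖) ↔ u - v ∈ Kᗮ := by
  have key := K.norm_eq_iInf_iff_inner_eq_zero (u := u) hv
  rw [Submodule.mem_orthogonal']
  rw [← key]
  have hbdd : BddBelow (Set.range fun w : K => ‖u - w‖) :=
    ⟨0, by rintro _ ⟨w, rfl⟩; exact norm_nonneg _⟩
  constructor
  · intro h
    exact le_antisymm (le_ciInf fun w => h w w.2) (ciInf_le hbdd ⟨v, hv⟩)
  · intro h w hw
    rw [h]
    exact ciInf_le hbdd ⟨w, hw⟩

theorem isLeastSquareSolution_iff (T : H₁ →L[ℂ] H₂) (y : H₂) (u : H₁) :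
    IsLeastSquareSolution T y u ↔ y - T u ∈ (range T)ᗮ := by
  rw [← forall_norm_sub_le_iff (range T) (u := y) (v := T u) ⟨u, rfl⟩]
  constructor
  · rintro h _ ⟨x, rfl⟩
    rw [norm_sub_rev, norm_sub_rev y]
    exact h x
  · intro h x
    rw [norm_sub_rev, norm_sub_rev _ y]
    exact h _ ⟨x, rfl⟩

theorem isMinimalLeastSquareSolution_iff (T : H₁ →L[ℂ] H₂) (y : H₂) (u : H₁) :
    IsMinimalLeastSquareSolution T y u ↔ y - T u ∈ (range T)ᗮ ∧ u ∈ (nullSpace T)ᗮ := by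
  unfold IsMinimalLeastSquareSolution
  rw [isLeastSquareSolution_iff]
  refine and_congr_right fun hu => ?_
  have key := forall_norm_sub_le_iff (nullSpace T) (u := u) (v := 0) (Submodule.zero_mem _)
  rw [sub_zero] at key
  rw [← key]
  constructor
  · intro h w hw
    refine h _ ((isLeastSquareSolution_iff T y _).2 ?_)
    have hw' : T w = 0 := hw
    rwa [map_sub, hw', sub_zero]
  · intro h v hv
    rw [isLeastSquareSolution_iff] at hv
    have h1 : T v - T u ∈ (range T)ᗮ := by
      have := Submodule.sub_mem _ hu hv
      rwa [sub_sub_sub_cancel_left] at this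
    have h2 : T v - T u ∈ range T := ⟨v - u, by simp⟩
    have h3 : T v - T u = 0 :=
      inner_self_eq_zero.1 (Submodule.inner_right_of_mem_orthogonal (𝕜 := ℂ) h2 h1)
    have h4 : u - v ∈ nullSpace T := by
      change T (u - v) = 0
      rw [map_sub, ← neg_sub, h3, neg_zero]
    simpa using h _ h4

theorem existsUnique_isMinimalLeastSquareSolution [CompleteSpace H₁] (T : H₁ →L[ℂ] H₂) {y : H₂}
    (hy : y ∈ range T ⊔ (range T)ᗮ) : ∃! u, IsMinimalLeastSquareSolution T y u := by
  simp only [isMinimalLeastSquareSolution_iff]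
  obtain ⟨_, ⟨x, rfl⟩, n, hn, rfl⟩ := Submodule.mem_sup.1 hy
  have hc : IsClosed (nullSpace T : Set H₁) := T.isClosed_ker
  have : CompleteSpace (nullSpace T) := hc.completeSpace_coe
  obtain ⟨p, hp, q, hq, rfl⟩ := (nullSpace T).exists_add_mem_mem_orthogonal x
  have hp' : T p = 0 := hp
  refine ⟨q, ⟨?_, hq⟩, ?_⟩
  · simpa [hp'] using hn
  · rintro v ⟨hv1, hv2⟩
    have h0 : T p + T q + n - T v ∈ (range T)ᗮ := by simpa using hv1
    have h1 : T q - T v ∈ (range T)ᗮ := by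
      have := Submodule.sub_mem _ h0 hn
      rw [hp'] at this
      convert this using 1
      abel
    have h2 : T q - T v ∈ range T := ⟨q - v, by simp⟩
    have h3 : T q - T v = 0 :=
      inner_self_eq_zero.1 (Submodule.inner_right_of_mem_orthogonal (𝕜 := ℂ) h2 h1)
    have h4 : v - q ∈ nullSpace T := by
      change T (v - q) = 0
      rw [map_sub, ← neg_sub, h3, neg_zero]
    exact sub_eq_zero.1 (inner_self_eq_zero.1 (Submodule.inner_right_of_mem_orthogonal (𝕜 := ℂ)
      h4 (Submodule.sub_mem _ hv2 hq)))

/-- The Moore-Penrose inverse `T†`: the operator with domain `R(T) ⊕ R(T)ᗮ` that assigns to `y`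
the unique least square solution of minimal norm of `T x = y`. -/
def moorePenrose [CompleteSpace H₁] (T : H₁ →L[ℂ] H₂) : H₂ →ₗ.[ℂ] H₁ where
  domain := range T ⊔ (range T)ᗮ
  toFun :=
    { toFun := fun y => (existsUnique_isMinimalLeastSquareSolution T y.2).choose
      map_add' := by
        intro y z
        have hy := (isMinimalLeastSquareSolution_iff T _ _).1
          (existsUnique_isMinimalLeastSquareSolution T y.2).choose_spec.1
        have hz := (isMinimalLeastSquareSolution_iff T _ _).1
          (existsUnique_isMinimalLeastSquareSolution T z.2).choose_spec.1
        refine ((existsUnique_isMinimalLeastSquareSolution T (y + z).2).choose_spec.2 _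
          ((isMinimalLeastSquareSolution_iff T _ _).2 ⟨?_, Submodule.add_mem _ hy.2 hz.2⟩)).symm
        rw [map_add, Submodule.coe_add, add_sub_add_comm]
        exact Submodule.add_mem _ hy.1 hz.1
      map_smul' := by
        intro c y
        have hy := (isMinimalLeastSquareSolution_iff T _ _).1
          (existsUnique_isMinimalLeastSquareSolution T y.2).choose_spec.1
        refine ((existsUnique_isMinimalLeastSquareSolution T (c • y).2).choose_spec.2 _
          ((isMinimalLeastSquareSolution_iff T _ _).2 ⟨?_, Submodule.smul_mem _ _ hy.2⟩)).symm
        rw [RingHom.id_apply, map_smul, Submodule.coe_smul, ← smul_sub]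
        exact Submodule.smul_mem _ _ hy.1 }

theorem isMinimalLeastSquareSolution_moorePenrose [CompleteSpace H₁] (T : H₁ →L[ℂ] H₂)
    (y : (moorePenrose T).domain) : IsMinimalLeastSquareSolution T y (moorePenrose T y) :=
  (existsUnique_isMinimalLeastSquareSolution T y.2).choose_spec.1

end HilbertOperator

end

/-! Put `N = N(T)`. Since `N(T) = N(T*) = R(T)ᗮ`, `T` maps into `Nᗮ`, where it is injective, and
`T†` inverts it there.

Paranormality: insert `x = T†T†y` into `‖Tx‖² ≤ ‖x‖‖T²x‖`. Since `TT†` fixes `T†y`, this reads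
`‖T†y‖² ≤ ‖T†T†y‖‖TT†y‖`, and `TT†` is a contraction. The converse inserts `T²x` into the inequality
for `T†`. Boundedness of `T†` plays no role.

Attainment: an AM operator attains a positive minimum on `Nᗮ`, so `R(T)` is closed and `T†` is
bounded. On closed subspaces of `Nᗮ`, inversion exchanges minimizers of one operator with maximizers
of the other (`InverseOnOrthogonal.normAttaining`, `InverseOnOrthogonal.minimumAttaining`). A
general closed `M` needs two more facts. Either `N` or `Nᗮ` is finite dimensional (the two
`finiteDimensional_or` lemmas): otherwise mixing vectors of both yields a diagonal operator with a
strictly monotone diagonal, which misses its extremum. And attainment on `M ⊓ Dᗮ` with `D` finite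
dimensional gives attainment on `M` (the two `of_inf_orthogonal` lemmas); it is applied with `D = N`
or `D = Nᗮ`. -/

namespace HilbertOperator

open Filter Topology

/-! ### Attainment and finite-codimensional subspaces -/

section Attainment

variable {E F : Type*} [NormedAddCommGroup E] [InnerProductSpace ℂ E]
  [NormedAddCommGroup F] [InnerProductSpace ℂ F]

theorem normAttaining_comp_subtypeL_iff (A : E →L[ℂ] F) (M : Submodule ℂ E) :
    NormAttaining (A ∘L M.subtypeL) ↔
      ∃ x ∈ M, ‖x‖ = 1 ∧ ∀ z ∈ M, ‖A z‖ ≤ ‖A x‖ * ‖z‖ := by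
  constructor
  · rintro ⟨x, hx, h⟩
    refine ⟨x, x.2, hx, fun z hz => ?_⟩
    have := (A ∘L M.subtypeL).le_opNorm ⟨z, hz⟩
    rw [← h] at this
    simpa using this
  · rintro ⟨x, hxM, hx, h⟩
    refine ⟨⟨x, hxM⟩, hx, le_antisymm ?_ ?_⟩
    · simpa [hx] using (A ∘L M.subtypeL).le_opNorm ⟨x, hxM⟩
    · exact (A ∘L M.subtypeL).opNorm_le_bound (norm_nonneg _) fun z => by simpa using h z z.2

theorem minimumAttaining_comp_subtypeL_iff (A : E →L[ℂ] F) (M : Submodule ℂ E) :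
    MinimumAttaining (A ∘L M.subtypeL) ↔
      ∃ x ∈ M, ‖x‖ = 1 ∧ ∀ z ∈ M, ‖A x‖ * ‖z‖ ≤ ‖A z‖ := by
  constructor
  · rintro ⟨x, hx, h⟩
    refine ⟨x, x.2, hx, fun z hz => ?_⟩
    rcases eq_or_ne z 0 with rfl | hz0
    · simp
    have hzn : 0 < ‖z‖ := norm_pos_iff.2 hz0
    have key : ‖(A ∘L M.subtypeL) x‖ ≤ ‖(A ∘L M.subtypeL) ((‖z‖⁻¹ : ℂ) • (⟨z, hz⟩ : M))‖ := by
      rw [h]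
      refine csInf_le ⟨0, ?_⟩ ⟨(‖z‖⁻¹ : ℂ) • (⟨z, hz⟩ : M), ?_, rfl⟩
      · rintro _ ⟨y, -, rfl⟩
        exact norm_nonneg _
      · rw [norm_smul]
        simp [hzn.ne']
    rw [map_smul, norm_smul] at key
    simp only [norm_inv, Complex.norm_real, norm_norm] at key
    rwa [inv_mul_eq_div, le_div_iff₀ hzn] at key
  · rintro ⟨x, hxM, hx, h⟩
    have hleast : IsLeast {r : ℝ | ∃ x : M, ‖x‖ = 1 ∧ ‖(A ∘L M.subtypeL) x‖ = r} ‖A x‖ := by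
      refine ⟨⟨⟨x, hxM⟩, hx, rfl⟩, ?_⟩
      rintro _ ⟨z, hz, rfl⟩
      have hz' : ‖(z : E)‖ = 1 := hz
      simpa [hz'] using h z z.2
    exact ⟨⟨x, hxM⟩, hx, hleast.csInf_eq.symm⟩

/-- A nonnegative quadratic form `a ‖x‖² + b ‖A x‖²` on `M` which is coercive on a subspace of
finite codimension attains the value `0` on the unit sphere as soon as it comes close to it. -/
theorem exists_quadratic_eq_zero [CompleteSpace E] (A : E →L[ℂ] F) (a b : ℝ)
    {M D : Submodule ℂ E} (hM : IsClosed (M : Set E)) [FiniteDimensional ℂ D]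
    (hq : ∀ x ∈ M, 0 ≤ a * ‖x‖ ^ 2 + b * ‖A x‖ ^ 2) {c : ℝ} (hc : 0 < c)
    (hcoer : ∀ x ∈ M ⊓ Dᗮ, c * ‖x‖ ^ 2 ≤ a * ‖x‖ ^ 2 + b * ‖A x‖ ^ 2)
    (hinf : ∀ ε > 0, ∃ x ∈ M, ‖x‖ = 1 ∧ a * ‖x‖ ^ 2 + b * ‖A x‖ ^ 2 < ε) :
    ∃ x ∈ M, ‖x‖ = 1 ∧ a * ‖x‖ ^ 2 + b * ‖A x‖ ^ 2 = 0 := by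
  set q : E → ℝ := fun x => a * ‖x‖ ^ 2 + b * ‖A x‖ ^ 2 with hqdef
  have hqc : Continuous q := by fun_prop
  -- Parallelogram law for `q`, with the nonnegative term `q (x + y)` dropped.
  have hpar : ∀ x ∈ M, ∀ y ∈ M, q (x - y) ≤ 2 * q x + 2 * q y := by
    intro x hx y hy
    have h1 := parallelogram_law_with_norm ℂ x y
    have h2 := parallelogram_law_with_norm ℂ (A x) (A y)
    have h3 := hq (x + y) (M.add_mem hx hy)
    rw [map_add] at h3
    simp only [hqdef, map_sub]
    linear_combination h3 + a * h1 + b * h2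
  set W : Submodule ℂ E := M ⊓ Dᗮ with hWdef
  have hWc : IsClosed (W : Set E) := hM.inter D.isClosed_orthogonal
  have : CompleteSpace W := hWc.completeSpace_coe
  set V : Submodule ℂ E := M ⊓ Wᗮ with hVdef
  -- Projection onto `D` is injective on `V`: its kernel there lies in `W ⊓ Wᗮ`.
  have hfin : FiniteDimensional ℂ V := by
    refine FiniteDimensional.of_injective (D.orthogonalProjectionOnto.toLinearMap ∘ₗ V.subtype) ?_
    rw [← LinearMap.ker_eq_bot, LinearMap.ker_eq_bot']
    rintro ⟨x, hxM, hxW⟩ hx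
    have hxD : x ∈ Dᗮ := D.orthogonalProjectionOnto_eq_zero_iff.1 hx
    have : x = 0 := inner_self_eq_zero.1
      (Submodule.inner_right_of_mem_orthogonal (𝕜 := ℂ) (K := W) ⟨hxM, hxD⟩ hxW)
    exact Subtype.ext this
  choose x hxM hx1 hxq using fun n : ℕ => hinf (1 / ((n : ℝ) + 1)) (by positivity)
  have hqx : Tendsto (fun n => q (x n)) atTop (𝓝 0) :=
    squeeze_zero (fun n => hq _ (hxM n)) (fun n => (hxq n).le) tendsto_one_div_add_atTop_nhds_zero_nat
  set u : ℕ → E := fun n => (W.orthogonalProjectionOnto (x n) : E) with hu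
  have huW : ∀ n, u n ∈ W := fun n => (W.orthogonalProjectionOnto (x n)).2
  have hvV : ∀ n, x n - u n ∈ V := fun n =>
    ⟨M.sub_mem (hxM n) (huW n).1, W.sub_starProjection_mem_orthogonal (x n)⟩
  have hvb : ∀ n, (⟨x n - u n, hvV n⟩ : V) ∈ Metric.closedBall (0 : V) 2 := by
    intro n
    rw [mem_closedBall_zero_iff]
    have h1 : ‖u n‖ ≤ ‖x n‖ := W.norm_orthogonalProjectionOnto_apply_le (x n)
    have h2 := norm_sub_le (x n) (u n)
    rw [hx1] at h1 h2
    change ‖x n - u n‖ ≤ 2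
    linarith
  have : ProperSpace V := FiniteDimensional.proper ℂ V
  obtain ⟨v, -, φ, hφ, hv⟩ := (isCompact_closedBall (0 : V) 2).tendsto_subseq hvb
  have hv' : Tendsto (fun n => x (φ n) - u (φ n)) atTop (𝓝 (v : E)) :=
    (continuous_subtype_val.tendsto v).comp hv
  have hqx' := hqx.comp hφ.tendsto_atTop
  -- The `V`-parts converge along `φ` by compactness. For the `W`-parts, `hpar` makes `q` of their
  -- differences small, and coercivity turns this into smallness of the norm.
  have hucauchy : CauchySeq (u ∘ φ) := by
    have hlim : Tendsto (fun p : ℕ × ℕ => 4 * q (x (φ p.1)) + 4 * q (x (φ p.2)) +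
        2 * q ((x (φ p.1) - u (φ p.1)) - (x (φ p.2) - u (φ p.2)))) atTop (𝓝 0) := by
      rw [← prod_atTop_atTop_eq]
      have h1 := hqx'.comp (tendsto_fst (f := atTop (α := ℕ)) (g := atTop (α := ℕ)))
      have h2 := hqx'.comp (tendsto_snd (f := atTop (α := ℕ)) (g := atTop (α := ℕ)))
      have h3 := (hqc.tendsto _).comp
        ((hv'.comp (tendsto_fst (f := atTop (α := ℕ)) (g := atTop (α := ℕ)))).sub
        (hv'.comp (tendsto_snd (f := atTop (α := ℕ)) (g := atTop (α := ℕ)))))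
      have h4 := ((h1.const_mul 4).add (h2.const_mul 4)).add (h3.const_mul 2)
      simpa [hqdef, Function.comp_def] using h4
    rw [Metric.cauchySeq_iff']
    intro ε hε
    have hev := hlim.eventually (gt_mem_nhds (show 0 < c * ε ^ 2 by positivity))
    rw [eventually_atTop_prod_self'] at hev
    obtain ⟨n₀, hn₀⟩ := hev
    refine ⟨n₀, fun n hn => ?_⟩
    have hlt := hn₀ n hn n₀ le_rfl
    rw [dist_eq_norm]
    have h1 := hcoer _ (W.sub_mem (huW (φ n)) (huW (φ n₀)))
    have h2 := hpar (x (φ n) - x (φ n₀)) (M.sub_mem (hxM _) (hxM _))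
      ((x (φ n) - u (φ n)) - (x (φ n₀) - u (φ n₀))) (M.sub_mem (hvV _).1 (hvV _).1)
    have h3 := hpar (x (φ n)) (hxM _) (x (φ n₀)) (hxM _)
    have h4 : x (φ n) - x (φ n₀) - ((x (φ n) - u (φ n)) - (x (φ n₀) - u (φ n₀))) =
      u (φ n) - u (φ n₀) := by abel
    rw [h4] at h2
    change c * ‖u (φ n) - u (φ n₀)‖ ^ 2 ≤ q (u (φ n) - u (φ n₀)) at h1
    have h5 : c * ‖u (φ n) - u (φ n₀)‖ ^ 2 < c * ε ^ 2 := by linarith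
    exact lt_of_pow_lt_pow_left₀ 2 hε.le (lt_of_mul_lt_mul_left h5 hc.le)
  obtain ⟨w, hw⟩ := cauchySeq_tendsto_of_complete hucauchy
  have hxlim : Tendsto (fun n => x (φ n)) atTop (𝓝 (w + v)) := by
    simpa using hw.add hv'
  refine ⟨w + v, hM.mem_of_tendsto hxlim (Eventually.of_forall fun n => hxM _), ?_, ?_⟩
  · have := hxlim.norm
    simp only [hx1] at this
    exact tendsto_nhds_unique this tendsto_const_nhds
  · exact tendsto_nhds_unique ((hqc.tendsto _).comp hxlim) hqx'

theorem exists_mem_norm_eq_one {M : Submodule ℂ E} (hM : M ≠ ⊥) : ∃ x ∈ M, ‖x‖ = 1 := by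
  obtain ⟨x, hx, h0⟩ := M.ne_bot_iff.1 hM
  refine ⟨(‖x‖⁻¹ : ℂ) • x, M.smul_mem _ hx, ?_⟩
  rw [norm_smul]
  simp [h0]

/-- If the norm `s` is not attained on `M`, the maximum on `M ⊓ Dᗮ` is strictly below `s`. This gap
makes `s²‖x‖² - ‖A x‖²` coercive there, so `exists_quadratic_eq_zero` produces a maximizer on `M`
after all. -/
theorem NormAttaining.of_inf_orthogonal [CompleteSpace E] {A : E →L[ℂ] F} {M D : Submodule ℂ E}
    (hM : IsClosed (M : Set E)) (hM0 : M ≠ ⊥) [FiniteDimensional ℂ D]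
    (h : M ⊓ Dᗮ ≠ ⊥ → NormAttaining (A ∘L (M ⊓ Dᗮ).subtypeL)) :
    NormAttaining (A ∘L M.subtypeL) := by
  set s := ‖A ∘L M.subtypeL‖ with hs
  have hle : ∀ z ∈ M, ‖A z‖ ≤ s * ‖z‖ := fun z hz => (A ∘L M.subtypeL).le_opNorm ⟨z, hz⟩
  have hs0 : 0 ≤ s := norm_nonneg (A ∘L M.subtypeL)
  by_contra hcon
  obtain ⟨c, hc, hcoer⟩ : ∃ c > 0, ∀ x ∈ M ⊓ Dᗮ,
      c * ‖x‖ ^ 2 ≤ s ^ 2 * ‖x‖ ^ 2 + (-1) * ‖A x‖ ^ 2 := by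
    rcases eq_or_ne (M ⊓ Dᗮ) ⊥ with h0 | h0
    · refine ⟨1, one_pos, fun x hx => ?_⟩
      rw [h0, Submodule.mem_bot] at hx
      simp [hx]
    obtain ⟨x, hx, hx1, hmax⟩ := (normAttaining_comp_subtypeL_iff _ _).1 (h h0)
    have hxs : ‖A x‖ < s := by
      refine lt_of_le_of_ne (by simpa [hx1] using hle x hx.1) fun heq => hcon ?_
      exact ⟨⟨x, hx.1⟩, hx1, heq⟩
    refine ⟨s ^ 2 - ‖A x‖ ^ 2, sub_pos.2 (pow_lt_pow_left₀ hxs (norm_nonneg _) two_ne_zero), fun z hz => ?_⟩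
    have := pow_le_pow_left₀ (norm_nonneg _) (hmax z hz) 2
    rw [mul_pow] at this
    linarith
  obtain ⟨x, hx, hx1, hx0⟩ := exists_quadratic_eq_zero A (s ^ 2) (-1) hM
    (fun x hx => by nlinarith [pow_le_pow_left₀ (norm_nonneg _) (hle x hx) 2]) hc hcoer
    (by
      intro ε hε
      by_contra! hall
      have hbd : ∀ z ∈ M, ‖z‖ = 1 → ‖A z‖ ^ 2 ≤ s ^ 2 - ε := fun z hz hz1 => by
        have := hall z hz hz1
        rw [hz1] at this
        linarith
      obtain ⟨x₀, hx₀, hx₀1⟩ := exists_mem_norm_eq_one hM0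
      have hnn : 0 ≤ s ^ 2 - ε := (sq_nonneg _).trans (hbd x₀ hx₀ hx₀1)
      have : s ≤ √(s ^ 2 - ε) := by
        refine ContinuousLinearMap.opNorm_le_of_unit_norm (Real.sqrt_nonneg _) fun z hz => ?_
        exact Real.le_sqrt_of_sq_le (hbd z z.2 hz)
      have h2 := pow_le_pow_left₀ hs0 this 2
      rw [Real.sq_sqrt hnn] at h2
      linarith)
  refine hcon ⟨⟨x, hx⟩, hx1, ?_⟩
  have hsq : ‖A x‖ ^ 2 = s ^ 2 := by rw [hx1] at hx0; linarith
  exact (pow_left_inj₀ (norm_nonneg _) hs0 two_ne_zero).1 hsq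

/-- The same gap argument, with the form `‖A x‖² - m²‖x‖²`. -/
theorem MinimumAttaining.of_inf_orthogonal [CompleteSpace E] {A : E →L[ℂ] F} {M D : Submodule ℂ E}
    (hM : IsClosed (M : Set E)) (hM0 : M ≠ ⊥) [FiniteDimensional ℂ D]
    (h : M ⊓ Dᗮ ≠ ⊥ → MinimumAttaining (A ∘L (M ⊓ Dᗮ).subtypeL)) :
    MinimumAttaining (A ∘L M.subtypeL) := by
  set m := minimumModulus (A ∘L M.subtypeL) with hm
  have hm0 : 0 ≤ m := Real.sInf_nonneg (by rintro _ ⟨x, -, rfl⟩; exact norm_nonneg _)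
  have hle1 : ∀ z ∈ M, ‖z‖ = 1 → m ≤ ‖A z‖ := fun z hz hz1 =>
    csInf_le ⟨0, by rintro _ ⟨x, -, rfl⟩; exact norm_nonneg _⟩ ⟨⟨z, hz⟩, hz1, rfl⟩
  have hle : ∀ z ∈ M, m * ‖z‖ ≤ ‖A z‖ := by
    intro z hz
    rcases eq_or_ne z 0 with rfl | hz0
    · simp
    have hzn : 0 < ‖z‖ := norm_pos_iff.2 hz0
    have := hle1 ((‖z‖⁻¹ : ℂ) • z) (M.smul_mem _ hz) (by rw [norm_smul]; simp [hzn.ne'])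
    rw [map_smul, norm_smul] at this
    simp only [norm_inv, Complex.norm_real, norm_norm] at this
    rwa [inv_mul_eq_div, le_div_iff₀ hzn] at this
  by_contra hcon
  obtain ⟨c, hc, hcoer⟩ : ∃ c > 0, ∀ x ∈ M ⊓ Dᗮ,
      c * ‖x‖ ^ 2 ≤ (-m ^ 2) * ‖x‖ ^ 2 + 1 * ‖A x‖ ^ 2 := by
    rcases eq_or_ne (M ⊓ Dᗮ) ⊥ with h0 | h0
    · refine ⟨1, one_pos, fun x hx => ?_⟩
      rw [h0, Submodule.mem_bot] at hx
      simp [hx]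
    obtain ⟨x, hx, hx1, hmin⟩ := (minimumAttaining_comp_subtypeL_iff _ _).1 (h h0)
    have hxm : m < ‖A x‖ := by
      refine lt_of_le_of_ne (hle1 x hx.1 hx1) fun heq => hcon ?_
      exact ⟨⟨x, hx.1⟩, hx1, heq.symm⟩
    refine ⟨‖A x‖ ^ 2 - m ^ 2, sub_pos.2 (pow_lt_pow_left₀ hxm hm0 two_ne_zero), fun z hz => ?_⟩
    have := pow_le_pow_left₀ (by positivity) (hmin z hz) 2
    rw [mul_pow] at this
    linarith
  obtain ⟨x, hx, hx1, hx0⟩ := exists_quadratic_eq_zero A (-m ^ 2) 1 hM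
    (fun x hx => by nlinarith [pow_le_pow_left₀ (by positivity) (hle x hx) 2]) hc hcoer
    (by
      intro ε hε
      have hlt : m < √(m ^ 2 + ε) := Real.lt_sqrt_of_sq_lt (by linarith)
      obtain ⟨x₀, hx₀, hx₀1⟩ := exists_mem_norm_eq_one hM0
      have hne : {r : ℝ | ∃ x : M, ‖x‖ = 1 ∧ ‖(A ∘L M.subtypeL) x‖ = r}.Nonempty :=
        ⟨_, ⟨x₀, hx₀⟩, hx₀1, rfl⟩
      obtain ⟨_, ⟨z, hz1, rfl⟩, hz⟩ := exists_lt_of_csInf_lt hne hlt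
      refine ⟨z, z.2, hz1, ?_⟩
      have hz1' : ‖(z : E)‖ = 1 := hz1
      have h2 : ‖A z‖ < √(m ^ 2 + ε) := hz
      have h3 := (Real.lt_sqrt (norm_nonneg _)).1 h2
      rw [hz1']
      linarith)
  refine hcon ⟨⟨x, hx⟩, hx1, ?_⟩
  have hsq : ‖A x‖ ^ 2 = m ^ 2 := by rw [hx1] at hx0; linarith
  exact (pow_left_inj₀ (norm_nonneg _) hm0 two_ne_zero).1 hsq

end Attainment

/-! ### Diagonal restrictions whose extrema are not attained -/

section NonAttainment

variable {E F : Type*} [NormedAddCommGroup E] [InnerProductSpace ℂ E] [CompleteSpace E]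
  [NormedAddCommGroup F] [InnerProductSpace ℂ F]

open scoped InnerProductSpace

/-- An infinite dimensional subspace contains an orthonormal sequence with orthogonal images. -/
theorem exists_orthonormal_seq_orthogonal_image [CompleteSpace F] (A : E →L[ℂ] F) {V : Submodule ℂ E}
    (hV : ¬ FiniteDimensional ℂ V) :
    ∃ e : ℕ → E, (∀ n, e n ∈ V) ∧ Orthonormal ℂ e ∧ Pairwise fun m n => ⟪A (e m), A (e n)⟫_ℂ = 0 := by
  classical
  set r : E → E → Prop := fun x y => ⟪x, y⟫_ℂ = 0 ∧ ⟪A x, A y⟫_ℂ = 0 with hr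
  have hsymm : Std.Symm r := ⟨fun x y h =>
    ⟨inner_eq_zero_symm.1 h.1, inner_eq_zero_symm.1 h.2⟩⟩
  obtain ⟨e, he, hpair⟩ := exists_seq_of_forall_finset_exists' (fun x : E => x ∈ V ∧ ‖x‖ = 1) r (by
    intro s _
    -- Orthogonality of `y` to `A*A x` is orthogonality of `A y` to `A x`.
    set D : Submodule ℂ E :=
      Submodule.span ℂ (↑(s ∪ s.image fun x => ContinuousLinearMap.adjoint A (A x)) : Set E) with hD
    have : FiniteDimensional ℂ D := FiniteDimensional.span_finset ℂ _
    have hne : V ⊓ Dᗮ ≠ ⊥ := by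
      intro hbot
      refine hV (FiniteDimensional.of_injective
        (D.orthogonalProjectionOnto.toLinearMap ∘ₗ V.subtype) ?_)
      rw [← LinearMap.ker_eq_bot, LinearMap.ker_eq_bot']
      rintro ⟨x, hxV⟩ hx
      have hxD : x ∈ Dᗮ := D.orthogonalProjectionOnto_eq_zero_iff.1 hx
      have : x ∈ V ⊓ Dᗮ := ⟨hxV, hxD⟩
      rw [hbot, Submodule.mem_bot] at this
      exact Subtype.ext this
    obtain ⟨y, hy, hy1⟩ := exists_mem_norm_eq_one hne
    refine ⟨y, ⟨hy.1, hy1⟩, fun x hx => ⟨?_, ?_⟩⟩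
    · exact Submodule.inner_right_of_mem_orthogonal (Submodule.subset_span (by simp [hx])) hy.2
    · rw [← ContinuousLinearMap.adjoint_inner_left]
      refine Submodule.inner_right_of_mem_orthogonal (Submodule.subset_span ?_) hy.2
      rw [Finset.coe_union, Finset.coe_image]
      exact Or.inr ⟨x, hx, rfl⟩)
  exact ⟨e, fun n => (he n).1, ⟨fun n => (he n).2, fun m n h => (hpair h).1⟩,
    fun m n h => (hpair h).2⟩

/-- On the closed span of an orthonormal sequence `g` with orthogonal images, the norm of `A` is
given by the norms `‖A (g k)‖`. -/
theorem exists_closed_submodule_diagonal (A : E →L[ℂ] F) {g : ℕ → E} (hg : Orthonormal ℂ g)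
    (hAg : Pairwise fun m n => ⟪A (g m), A (g n)⟫_ℂ = 0) :
    ∃ M : Submodule ℂ E, IsClosed (M : Set E) ∧ (∀ k, g k ∈ M) ∧
      ∀ y ∈ M, ∃ a : ℕ → ℝ, (∀ k, 0 ≤ a k) ∧ HasSum a (‖y‖ ^ 2) ∧
        HasSum (fun k => a k * ‖A (g k)‖ ^ 2) (‖A y‖ ^ 2) := by
  set M := (Submodule.span ℂ (Set.range g)).topologicalClosure with hM
  have hMc : IsClosed (M : Set E) := Submodule.isClosed_topologicalClosure _
  have hgM : ∀ k, g k ∈ M := fun k =>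
    Submodule.le_topologicalClosure _ (Submodule.subset_span ⟨k, rfl⟩)
  refine ⟨M, hMc, hgM, fun y hy => ?_⟩
  have hexp : HasSum (fun k => ⟪g k, y⟫_ℂ • g k) y := by
    have hO := hg.orthogonalFamily
    have hr := hO.range_linearIsometry
    have hy' : y ∈ LinearMap.range hO.linearIsometry.toLinearMap := by
      rw [hr]
      refine Submodule.topologicalClosure_mono ?_ hy
      rw [Submodule.span_le]
      rintro _ ⟨k, rfl⟩
      exact Submodule.mem_iSup_of_mem k ⟨1, by simp⟩
    obtain ⟨f, rfl⟩ := hy'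
    have hs := hO.hasSum_linearIsometry f
    simp only [LinearIsometry.toSpanSingleton_apply] at hs
    have hcoef : ∀ k, ⟪g k, hO.linearIsometry f⟫_ℂ = f k := by
      intro k
      have h1 := hs.mapL (innerSL ℂ (g k))
      refine (h1.unique (hasSum_single k fun j hj => ?_)).trans ?_
      · rw [innerSL_apply_apply, inner_smul_right, hg.2 hj.symm, mul_zero]
      · rw [innerSL_apply_apply, inner_smul_right, orthonormal_iff_ite.1 hg, if_pos rfl, mul_one]
    change HasSum (fun k => ⟪g k, hO.linearIsometry f⟫_ℂ • g k) (hO.linearIsometry f)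
    simp only [hcoef]
    exact hs
  have hAexp : HasSum (fun k => ⟪g k, y⟫_ℂ • A (g k)) (A y) := by
    simpa using hexp.mapL A
  have hAcoef : ∀ k, ⟪A y, A (g k)⟫_ℂ = ⟪y, g k⟫_ℂ * ((‖A (g k)‖ ^ 2 : ℝ) : ℂ) := by
    intro k
    have h1 := hAexp.mapL (innerSL ℂ (A (g k)))
    have h2 : ⟪A (g k), A y⟫_ℂ = ⟪g k, y⟫_ℂ * ((‖A (g k)‖ ^ 2 : ℝ) : ℂ) := by
      refine (h1.unique (hasSum_single k fun j hj => ?_)).trans ?_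
      · rw [innerSL_apply_apply, inner_smul_right, hAg hj.symm, mul_zero]
      · rw [innerSL_apply_apply, inner_smul_right, inner_self_eq_norm_sq_to_K]
        push_cast
        rfl
    rw [← inner_conj_symm, h2, map_mul, inner_conj_symm, Complex.conj_ofReal]
  have hconj : ∀ k, ⟪g k, y⟫_ℂ * ⟪y, g k⟫_ℂ = ((‖⟪g k, y⟫_ℂ‖ ^ 2 : ℝ) : ℂ) := by
    intro k
    rw [← inner_conj_symm y, Complex.mul_conj, Complex.normSq_eq_norm_sq]
  refine ⟨fun k => ‖⟪g k, y⟫_ℂ‖ ^ 2, fun k => by positivity, ?_, ?_⟩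
  · have h := hexp.mapL (innerSL ℂ y)
    simp only [innerSL_apply_apply, inner_smul_right, hconj] at h
    rw [show ⟪y, y⟫_ℂ = ((‖y‖ ^ 2 : ℝ) : ℂ) by
      rw [inner_self_eq_norm_sq_to_K]; push_cast; rfl] at h
    exact Complex.hasSum_ofReal.1 h
  · have h := hAexp.mapL (innerSL ℂ (A y))
    simp only [innerSL_apply_apply, inner_smul_right, hAcoef, ← mul_assoc, hconj] at h
    rw [show ⟪A y, A y⟫_ℂ = ((‖A y‖ ^ 2 : ℝ) : ℂ) by
      rw [inner_self_eq_norm_sq_to_K]; push_cast; rfl] at h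
    simp only [← Complex.ofReal_mul] at h
    exact Complex.hasSum_ofReal.1 h

/-- If both `V` and its orthogonal complement are infinite dimensional and `A` vanishes on `Vᗮ`,
then `A` is diagonal with prescribed small enough diagonal on some closed subspace. -/
theorem exists_closed_submodule_diagonal_of_le [CompleteSpace F] (A : E →L[ℂ] F) {N : Submodule ℂ E}
    (hAN : ∀ x ∈ N, A x = 0) (hN : ¬ FiniteDimensional ℂ N) (hV : ¬ FiniteDimensional ℂ Nᗮ) :
    ∃ e : ℕ → E, (∀ k, e k ∈ Nᗮ) ∧ (∀ k, ‖e k‖ = 1) ∧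
      ∀ s : ℕ → ℝ, (∀ k, 0 ≤ s k) → (∀ k, s k ≤ ‖A (e k)‖) →
        ∃ (M : Submodule ℂ E) (g : ℕ → E), IsClosed (M : Set E) ∧ (∀ k, g k ∈ M) ∧
          (∀ k, ‖g k‖ = 1) ∧ (∀ k, ‖A (g k)‖ = s k) ∧
          ∀ y ∈ M, ∃ a : ℕ → ℝ, (∀ k, 0 ≤ a k) ∧ HasSum a (‖y‖ ^ 2) ∧
            HasSum (fun k => a k * s k ^ 2) (‖A y‖ ^ 2) := by
  obtain ⟨e, heV, he, hAe⟩ := exists_orthonormal_seq_orthogonal_image A hV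
  obtain ⟨f, hfN, hf, -⟩ := exists_orthonormal_seq_orthogonal_image A hN
  refine ⟨e, heV, he.1, fun s hs0 hs => ?_⟩
  have hfe : ∀ i j, ⟪f i, e j⟫_ℂ = 0 := fun i j =>
    Submodule.inner_right_of_mem_orthogonal (hfN i) (heV j)
  have hef : ∀ i j, ⟪e i, f j⟫_ℂ = 0 := fun i j => inner_eq_zero_symm.1 (hfe j i)
  have hquot : ∀ k, 0 ≤ s k / ‖A (e k)‖ ∧ s k / ‖A (e k)‖ ≤ 1 := fun k =>
    ⟨div_nonneg (hs0 k) (norm_nonneg _), div_le_one_of_le₀ (hs k) (norm_nonneg _)⟩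
  set c : ℕ → ℝ := fun k => s k / ‖A (e k)‖ with hc
  set d : ℕ → ℝ := fun k => √(1 - c k ^ 2) with hd
  have hcd : ∀ k, c k * c k + d k * d k = 1 := fun k => by
    have : 0 ≤ 1 - c k ^ 2 := by nlinarith [(hquot k).1, (hquot k).2]
    rw [hd, Real.mul_self_sqrt this]
    ring
  -- Tilting `e k` towards the null vector `f k` keeps the norm 1 and scales the image by `c k`,
  -- which lowers its norm to `s k`.
  set g : ℕ → E := fun k => (c k : ℂ) • e k + (d k : ℂ) • f k with hgdef
  have hAg : ∀ k, A (g k) = (c k : ℂ) • A (e k) := fun k => by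
    simp [hgdef, hAN _ (hfN k)]
  have hgo : Orthonormal ℂ g := by
    rw [orthonormal_iff_ite]
    intro i j
    simp only [hgdef, inner_add_left, inner_add_right, inner_smul_left, inner_smul_right, hef, hfe,
      orthonormal_iff_ite.1 he, orthonormal_iff_ite.1 hf, Complex.conj_ofReal]
    by_cases h : i = j
    · subst h
      simp only [if_true, mul_one, mul_zero, add_zero, zero_add]
      exact_mod_cast hcd i
    · simp [h]
  have hnorm : ∀ k, ‖A (g k)‖ = s k := fun k => by
    rw [hAg, norm_smul, Complex.norm_real, Real.norm_of_nonneg (hquot k).1]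
    exact div_mul_cancel_of_imp fun h => le_antisymm (h ▸ hs k) (hs0 k)
  obtain ⟨M, hM, hgM, hMd⟩ := exists_closed_submodule_diagonal A hgo fun m n hmn => by
    simp only [hAg, inner_smul_left, inner_smul_right, hAe hmn, mul_zero]
  simp only [hnorm] at hMd
  exact ⟨M, g, hM, hgM, hgo.1, hnorm, hMd⟩

theorem exists_coeff_pos {a : ℕ → ℝ} (ha : ∀ k, 0 ≤ a k) {t : ℝ} (ht : t ≠ 0) (h : HasSum a t) :
    ∃ k, 0 < a k := by
  by_contra! hcon
  have : a = 0 := funext fun k => le_antisymm (hcon k) (ha k)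
  subst this
  exact ht (h.unique hasSum_zero)

/-- Otherwise realize a strictly decreasing positive diagonal `s`. A minimizer `y` has `‖A y‖ < s k`
for every `k`, yet `‖A y‖²` is a convex combination of the `s k ^ 2`. -/
theorem AbsolutelyMinimumAttaining.finiteDimensional_or [CompleteSpace F] {A : E →L[ℂ] F}
    (hA : AbsolutelyMinimumAttaining A) {N : Submodule ℂ E} (hAN : ∀ x ∈ N, A x = 0)
    (hinj : ∀ x ∈ Nᗮ, A x = 0 → x = 0) :
    FiniteDimensional ℂ N ∨ FiniteDimensional ℂ Nᗮ := by
  by_contra! hcon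
  obtain ⟨e, heN, he1, hdiag⟩ := exists_closed_submodule_diagonal_of_le A hAN hcon.1 hcon.2
  have hpos : ∀ k, 0 < ‖A (e k)‖ := fun k => norm_pos_iff.2 fun h0 => by
    have := he1 k
    rw [hinj _ (heN k) h0, norm_zero] at this
    exact zero_ne_one this
  obtain ⟨s, hs0, hsle, hanti⟩ : ∃ s : ℕ → ℝ, (∀ k, 0 < s k) ∧ (∀ k, s k ≤ ‖A (e k)‖) ∧
      ∀ k, s (k + 1) < s k := by
    -- Halving forces strict decrease; the minimum keeps each term below `‖A (e k)‖`.
    refine ⟨fun k => Nat.rec ‖A (e 0)‖ (fun n t => min (t / 2) ‖A (e (n + 1))‖) k, ?_, ?_, ?_⟩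
    · intro k
      induction k with
      | zero => exact hpos 0
      | succ n ih => exact lt_min (half_pos ih) (hpos _)
    · intro k
      cases k with
      | zero => exact le_rfl
      | succ n => exact min_le_right _ _
    · intro k
      have : ∀ k, 0 < (Nat.rec ‖A (e 0)‖ (fun n t => min (t / 2) ‖A (e (n + 1))‖) k : ℝ) := by
        intro k
        induction k with
        | zero => exact hpos 0
        | succ n ih => exact lt_min (half_pos ih) (hpos _)
      exact (min_le_left _ _).trans_lt (half_lt_self (this k))
  obtain ⟨M, g, hM, hgM, hg1, hgs, hexp⟩ := hdiag s (fun k => (hs0 k).le) hsle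
  have hM0 : M ≠ ⊥ := by
    rintro rfl
    have := hg1 0
    rw [(Submodule.mem_bot ℂ).1 (hgM 0), norm_zero] at this
    exact zero_ne_one this
  obtain ⟨y, hy, hy1, hmin⟩ := (minimumAttaining_comp_subtypeL_iff _ _).1 (hA M hM hM0)
  obtain ⟨a, ha0, ha1, ha2⟩ := hexp y hy
  have hlt : ∀ k, ‖A y‖ ^ 2 < s k ^ 2 := fun k => by
    have h1 := hmin _ (hgM (k + 1))
    rw [hg1, hgs, mul_one] at h1
    exact pow_lt_pow_left₀ (h1.trans_lt (hanti k)) (norm_nonneg _) two_ne_zero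
  rw [hy1, one_pow] at ha1
  obtain ⟨k, hk⟩ := exists_coeff_pos ha0 one_ne_zero ha1
  have := hasSum_lt (fun j => mul_le_mul_of_nonneg_left (hlt j).le (ha0 j))
    (mul_lt_mul_of_pos_left (hlt k) hk) (ha1.mul_right (‖A y‖ ^ 2)) ha2
  linarith

/-- Dual argument with a strictly increasing diagonal. It must stay below every `‖A (e k)‖`, whence
the uniform lower bound `c`. -/
theorem AbsolutelyNormAttaining.finiteDimensional_or [CompleteSpace F] {A : E →L[ℂ] F}
    (hA : AbsolutelyNormAttaining A) {N : Submodule ℂ E} (hAN : ∀ x ∈ N, A x = 0)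
    {c : ℝ} (hc : 0 < c) (hbelow : ∀ x ∈ Nᗮ, c * ‖x‖ ≤ ‖A x‖) :
    FiniteDimensional ℂ N ∨ FiniteDimensional ℂ Nᗮ := by
  by_contra! hcon
  obtain ⟨e, heN, he1, hdiag⟩ := exists_closed_submodule_diagonal_of_le A hAN hcon.1 hcon.2
  set s : ℕ → ℝ := fun k => c * (1 - 1 / ((k : ℝ) + 1)) with hs
  have hs0 : ∀ k, 0 ≤ s k := fun k => by
    refine mul_nonneg hc.le (sub_nonneg.2 ?_)
    rw [div_le_one (by positivity)]
    linarith [(Nat.cast_nonneg k : (0 : ℝ) ≤ k)]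
  have hsle : ∀ k, s k ≤ ‖A (e k)‖ := fun k => by
    have h1 := hbelow _ (heN k)
    rw [he1, mul_one] at h1
    refine le_trans ?_ h1
    have : 0 ≤ c * (1 / ((k : ℝ) + 1)) := by positivity
    simp only [hs, mul_sub]
    linarith
  have hmono : ∀ k, s k < s (k + 1) := fun k => by
    refine mul_lt_mul_of_pos_left (sub_lt_sub_left ?_ _) hc
    refine one_div_lt_one_div_of_lt (by positivity) ?_
    push_cast
    linarith
  obtain ⟨M, g, hM, hgM, hg1, hgs, hexp⟩ := hdiag s hs0 hsle
  have hM0 : M ≠ ⊥ := by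
    rintro rfl
    have := hg1 0
    rw [(Submodule.mem_bot ℂ).1 (hgM 0), norm_zero] at this
    exact zero_ne_one this
  obtain ⟨y, hy, hy1, hmax⟩ := (normAttaining_comp_subtypeL_iff _ _).1 (hA M hM hM0)
  obtain ⟨a, ha0, ha1, ha2⟩ := hexp y hy
  have hlt : ∀ k, s k ^ 2 < ‖A y‖ ^ 2 := fun k => by
    have h1 := hmax _ (hgM (k + 1))
    rw [hg1, hgs, mul_one] at h1
    exact pow_lt_pow_left₀ ((hmono k).trans_le h1) (hs0 k) two_ne_zero
  rw [hy1, one_pow] at ha1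
  obtain ⟨k, hk⟩ := exists_coeff_pos ha0 one_ne_zero ha1
  have := hasSum_lt (fun j => mul_le_mul_of_nonneg_left (hlt j).le (ha0 j))
    (mul_lt_mul_of_pos_left (hlt k) hk) ha2 (ha1.mul_right (‖A y‖ ^ 2))
  linarith

end NonAttainment

/-! ### Homogeneous paranormality; injectivity off the null space -/

section Paranormal

variable {H : Type*} [NormedAddCommGroup H] [InnerProductSpace ℂ H]

theorem Paranormal.norm_sq_le {T : H →L[ℂ] H} (hT : Paranormal T) (x : H) :
    ‖T x‖ ^ 2 ≤ ‖x‖ * ‖T (T x)‖ := by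
  rcases eq_or_ne x 0 with rfl | hx
  · simp
  have hxn : 0 < ‖x‖ := norm_pos_iff.2 hx
  have h := hT ((‖x‖⁻¹ : ℂ) • x) (by rw [norm_smul]; simp [hxn.ne'])
  simp only [map_smul, norm_smul, norm_inv, Complex.norm_real, norm_norm] at h
  have h2 := mul_le_mul_of_nonneg_left h (sq_nonneg ‖x‖)
  calc ‖T x‖ ^ 2 = ‖x‖ ^ 2 * (‖x‖⁻¹ * ‖T x‖) ^ 2 := by field_simp
    _ ≤ ‖x‖ ^ 2 * (‖x‖⁻¹ * ‖T (T x)‖) := h2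
    _ = ‖x‖ * ‖T (T x)‖ := by field_simp

theorem ParanormalPMap.norm_sq_le {S : H →ₗ.[ℂ] H} (hS : ParanormalPMap S) (x : S.domain)
    (hx : S x ∈ S.domain) : ‖S x‖ ^ 2 ≤ ‖(x : H)‖ * ‖S ⟨S x, hx⟩‖ := by
  rcases eq_or_ne (x : H) 0 with h0 | h0
  · have : x = 0 := Subtype.ext h0
    subst this
    simp
  have hxn : 0 < ‖(x : H)‖ := norm_pos_iff.2 h0
  set c : ℂ := (‖(x : H)‖⁻¹ : ℂ) with hc
  have hcn : ‖c‖ = ‖(x : H)‖⁻¹ := by simp [hc]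
  have hmap : S (c • x) = c • S x := S.map_smul c x
  have hmem : S (c • x) ∈ S.domain := hmap ▸ S.domain.smul_mem c hx
  have h := hS (c • x) hmem (by
    rw [Submodule.coe_smul, norm_smul, hcn, inv_mul_cancel₀ hxn.ne'])
  have hmap2 : S ⟨S (c • x), hmem⟩ = c • S ⟨S x, hx⟩ := by
    rw [← S.map_smul]
    congr 1
    exact Subtype.ext hmap
  rw [hmap2, hmap, norm_smul, norm_smul, hcn] at h
  have h2 := mul_le_mul_of_nonneg_left h (sq_nonneg ‖(x : H)‖)
  calc ‖S x‖ ^ 2 = ‖(x : H)‖ ^ 2 * (‖(x : H)‖⁻¹ * ‖S x‖) ^ 2 := by field_simp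
    _ ≤ ‖(x : H)‖ ^ 2 * (‖(x : H)‖⁻¹ * ‖S ⟨S x, hx⟩‖) := h2
    _ = ‖(x : H)‖ * ‖S ⟨S x, hx⟩‖ := by field_simp

theorem eq_zero_of_mem_orthogonal_nullSpace {T : H →L[ℂ] H} {x : H} (hx : x ∈ (nullSpace T)ᗮ) (h : T x = 0) :
    x = 0 :=
  inner_self_eq_zero.1 (Submodule.inner_right_of_mem_orthogonal (𝕜 := ℂ) (K := nullSpace T) h hx)

theorem eq_of_mem_orthogonal_nullSpace {T : H →L[ℂ] H} {x y : H} (hx : x ∈ (nullSpace T)ᗮ)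
    (hy : y ∈ (nullSpace T)ᗮ) (h : T x = T y) : x = y :=
  sub_eq_zero.1 (eq_zero_of_mem_orthogonal_nullSpace (Submodule.sub_mem _ hx hy) (by
    rw [map_sub, h, sub_self]))

end Paranormal

/-! ### Moore–Penrose identities and paranormality -/

section MoorePenrose

variable {H : Type*} [NormedAddCommGroup H] [InnerProductSpace ℂ H] [CompleteSpace H]
  {T : H →L[ℂ] H}

theorem orthogonal_range_eq_nullSpace (hT : nullSpace T = nullSpace (ContinuousLinearMap.adjoint T)) :
    (range T)ᗮ = nullSpace T := by
  rw [hT]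
  exact ContinuousLinearMap.orthogonal_range T

theorem apply_mem_orthogonal_nullSpace
    (hT : nullSpace T = nullSpace (ContinuousLinearMap.adjoint T)) (x : H) :
    T x ∈ (nullSpace T)ᗮ := by
  rw [← orthogonal_range_eq_nullSpace hT]
  exact (range T).le_orthogonal_orthogonal ⟨x, rfl⟩

theorem moorePenrose_mem_orthogonal_nullSpace (y : (moorePenrose T).domain) :
    moorePenrose T y ∈ (nullSpace T)ᗮ :=
  ((isMinimalLeastSquareSolution_iff T _ _).1 (isMinimalLeastSquareSolution_moorePenrose T y)).2

theorem sub_apply_moorePenrose_mem (y : (moorePenrose T).domain) :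
    (y : H) - T (moorePenrose T y) ∈ (range T)ᗮ :=
  ((isMinimalLeastSquareSolution_iff T _ _).1 (isMinimalLeastSquareSolution_moorePenrose T y)).1

/-- Pythagoras: the residual `y - TT†y` is orthogonal to the range. -/
theorem norm_apply_moorePenrose_le (y : (moorePenrose T).domain) :
    ‖T (moorePenrose T y)‖ ≤ ‖(y : H)‖ := by
  have h := norm_add_sq_eq_norm_sq_add_norm_sq_of_inner_eq_zero (𝕜 := ℂ) (T (moorePenrose T y))
    ((y : H) - T (moorePenrose T y))
    (Submodule.inner_right_of_mem_orthogonal (K := range T) ⟨_, rfl⟩ (sub_apply_moorePenrose_mem y))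
  rw [add_sub_cancel] at h
  nlinarith [norm_nonneg (y : H), norm_nonneg (T (moorePenrose T y)),
    mul_self_nonneg ‖(y : H) - T (moorePenrose T y)‖]

theorem apply_mem_domain_moorePenrose (x : H) : T x ∈ (moorePenrose T).domain :=
  Submodule.mem_sup_left ⟨x, rfl⟩

theorem apply_moorePenrose_apply (x : H) :
    T (moorePenrose T ⟨T x, apply_mem_domain_moorePenrose x⟩) = T x := by
  have h := sub_apply_moorePenrose_mem ⟨T x, apply_mem_domain_moorePenrose x⟩
  have h2 : T x - T (moorePenrose T ⟨T x, apply_mem_domain_moorePenrose x⟩) ∈ range T :=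
    Submodule.sub_mem _ ⟨x, rfl⟩ ⟨_, rfl⟩
  exact (sub_eq_zero.1 (inner_self_eq_zero.1
    (Submodule.inner_right_of_mem_orthogonal (𝕜 := ℂ) h2 h))).symm

theorem moorePenrose_apply_of_mem {x : H} (hx : x ∈ (nullSpace T)ᗮ) :
    moorePenrose T ⟨T x, apply_mem_domain_moorePenrose x⟩ = x :=
  eq_of_mem_orthogonal_nullSpace (moorePenrose_mem_orthogonal_nullSpace _) hx
    (apply_moorePenrose_apply x)

/-- `x` itself solves the equation exactly, so it competes for minimal norm. -/
theorem norm_moorePenrose_apply_le (x : H) :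
    ‖moorePenrose T ⟨T x, apply_mem_domain_moorePenrose x⟩‖ ≤ ‖x‖ := by
  have h := (isMinimalLeastSquareSolution_moorePenrose T
    ⟨T x, apply_mem_domain_moorePenrose x⟩).2 x
  refine h fun z => ?_
  change ‖T x - T x‖ ≤ _
  rw [sub_self, norm_zero]
  exact norm_nonneg _

theorem paranormal_iff_paranormalPMap_moorePenrose
    (hT : nullSpace T = nullSpace (ContinuousLinearMap.adjoint T)) :
    Paranormal T ↔ ParanormalPMap (moorePenrose T) := by
  constructor
  · intro h y hy hy1
    -- The residual lies in `R(T)ᗮ = N(T)`, and both of its terms lie in `N(T)ᗮ`.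
    have hTx : T (moorePenrose T ⟨moorePenrose T y, hy⟩) = moorePenrose T y := by
      have h1 := sub_apply_moorePenrose_mem ⟨moorePenrose T y, hy⟩
      rw [orthogonal_range_eq_nullSpace hT] at h1
      have h2 := Submodule.sub_mem _ (moorePenrose_mem_orthogonal_nullSpace y)
        (apply_mem_orthogonal_nullSpace hT (moorePenrose T ⟨moorePenrose T y, hy⟩))
      exact (sub_eq_zero.1 (eq_zero_of_mem_orthogonal_nullSpace h2 h1)).symm
    have h3 := h.norm_sq_le (moorePenrose T ⟨moorePenrose T y, hy⟩)
    rw [hTx] at h3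
    have h4 := norm_apply_moorePenrose_le y
    rw [hy1] at h4
    exact h3.trans (mul_le_of_le_one_right (norm_nonneg _) h4)
  · intro h x hx1
    have hy : moorePenrose T ⟨T (T x), apply_mem_domain_moorePenrose _⟩ = T x :=
      moorePenrose_apply_of_mem (apply_mem_orthogonal_nullSpace hT x)
    have hmem : moorePenrose T ⟨T (T x), apply_mem_domain_moorePenrose _⟩ ∈
        (moorePenrose T).domain := by
      rw [hy]
      exact apply_mem_domain_moorePenrose x
    have h1 := h.norm_sq_le _ hmem
    have h2 : ‖moorePenrose T ⟨_, hmem⟩‖ ≤ 1 := by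
      rw [← hx1]
      simpa only [hy] using norm_moorePenrose_apply_le x
    simp only [hy] at h1
    simp only [hy] at h2
    exact h1.trans (mul_le_of_le_one_right (norm_nonneg _) h2)

theorem sub_apply_apply_mem_of_toPMap_eq {S : H →L[ℂ] H} (hS : toPMap S = moorePenrose T) (y : H) :
    y - T (S y) ∈ (range T)ᗮ ∧ S y ∈ (nullSpace T)ᗮ := by
  have hy : y ∈ (moorePenrose T).domain := hS ▸ Submodule.mem_top
  have h : moorePenrose T ⟨y, hy⟩ = S y := by
    obtain ⟨_, h⟩ := LinearPMap.ext_iff.1 hS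
    exact (h (x := y) (hf := Submodule.mem_top) (hg := hy)).symm
  exact h ▸ ⟨sub_apply_moorePenrose_mem ⟨y, hy⟩, moorePenrose_mem_orthogonal_nullSpace ⟨y, hy⟩⟩

/-- Closed range makes the domain everything, and `c‖T†y‖ ≤ ‖TT†y‖ ≤ ‖y‖`. -/
theorem exists_toPMap_eq_moorePenrose (hR : IsClosed (range T : Set H)) {c : ℝ} (hc : 0 < c)
    (hbelow : ∀ x ∈ (nullSpace T)ᗮ, c * ‖x‖ ≤ ‖T x‖) :
    ∃ S : H →L[ℂ] H, toPMap S = moorePenrose T := by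
  have : CompleteSpace (range T) := hR.completeSpace_coe
  have htop : (moorePenrose T).domain = ⊤ := (range T).sup_orthogonal_of_hasOrthogonalProjection
  have hmem : ∀ y, y ∈ (moorePenrose T).domain := fun y => htop ▸ Submodule.mem_top
  let S₀ : H →ₗ[ℂ] H := (moorePenrose T).toFun ∘ₗ LinearMap.id.codRestrict _ hmem
  have hS₀ : ∀ y, S₀ y = moorePenrose T ⟨y, hmem y⟩ := fun y => rfl
  refine ⟨S₀.mkContinuous c⁻¹ fun y => ?_, ?_⟩
  · rw [hS₀, inv_mul_eq_div, le_div_iff₀' hc]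
    exact (hbelow _ (moorePenrose_mem_orthogonal_nullSpace _)).trans
      (norm_apply_moorePenrose_le ⟨y, hmem y⟩)
  · refine LinearPMap.ext htop.symm ?_
    intro x _ _
    rfl

end MoorePenrose

/-! ### Exchanging minima and maxima under inversion -/

section Transfer

variable {H : Type*} [NormedAddCommGroup H] [InnerProductSpace ℂ H]

/-- `T` and `S` vanish on `N` and restrict to mutually inverse bijections of `Nᗮ`. -/
structure InverseOnOrthogonal (N : Submodule ℂ H) (T S : H →L[ℂ] H) : Prop where
  map_zero : ∀ x ∈ N, T x = 0
  map_zero' : ∀ x ∈ N, S x = 0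
  mem : ∀ x, T x ∈ Nᗮ
  mem' : ∀ x, S x ∈ Nᗮ
  left_inv : ∀ x ∈ Nᗮ, S (T x) = x
  right_inv : ∀ x ∈ Nᗮ, T (S x) = x

namespace InverseOnOrthogonal

variable {N : Submodule ℂ H} {T S : H →L[ℂ] H}

theorem symm (h : InverseOnOrthogonal N T S) : InverseOnOrthogonal N S T :=
  ⟨h.map_zero', h.map_zero, h.mem', h.mem, h.right_inv, h.left_inv⟩

theorem of_moorePenrose [CompleteSpace H] (hT : nullSpace T = nullSpace (ContinuousLinearMap.adjoint T))
    (hS : toPMap S = moorePenrose T) : InverseOnOrthogonal (nullSpace T) T S := by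
  have h : ∀ y, T (y - T (S y)) = 0 ∧ S y ∈ (nullSpace T)ᗮ := fun y => by
    have := sub_apply_apply_mem_of_toPMap_eq hS y
    rwa [orthogonal_range_eq_nullSpace hT] at this
  have hright : ∀ x ∈ (nullSpace T)ᗮ, T (S x) = x := fun x hx =>
    (sub_eq_zero.1 (eq_zero_of_mem_orthogonal_nullSpace
      (Submodule.sub_mem _ hx (apply_mem_orthogonal_nullSpace hT _)) (h x).1)).symm
  refine ⟨fun x hx => hx, fun x hx => ?_, apply_mem_orthogonal_nullSpace hT, fun x => (h x).2,
    fun x hx => ?_, hright⟩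
  -- Here `T (T (S x)) = 0`; injectivity on the complement is used twice, for `T (S x)` and for `S
  -- x`.
  · have hx' : T x = 0 := hx
    have h1 := (h x).1
    rw [map_sub, hx', zero_sub, neg_eq_zero] at h1
    exact eq_zero_of_mem_orthogonal_nullSpace (h x).2
      (eq_zero_of_mem_orthogonal_nullSpace (apply_mem_orthogonal_nullSpace hT _) h1)
  · exact eq_of_mem_orthogonal_nullSpace (h _).2 hx
      (hright _ (apply_mem_orthogonal_nullSpace hT x))

/-- The preimage in `Nᗮ` of a subspace `W ≤ Nᗮ` under `T`. -/
theorem exists_preimage (h : InverseOnOrthogonal N T S) {W : Submodule ℂ H}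
    (hWc : IsClosed (W : Set H)) (hWN : W ≤ Nᗮ) (hW : W ≠ ⊥) :
    ∃ W' : Submodule ℂ H, IsClosed (W' : Set H) ∧ W' ≠ ⊥ ∧ (∀ x ∈ W', x ∈ Nᗮ ∧ T x ∈ W) ∧
      ∀ y ∈ W, S y ∈ W' := by
  refine ⟨Nᗮ ⊓ W.comap (T : H →ₗ[ℂ] H), ?_, ?_, fun x hx => hx, fun y hy => ⟨h.mem' y, ?_⟩⟩
  · exact N.isClosed_orthogonal.inter (hWc.preimage T.continuous)
  · obtain ⟨y, hy, hy0⟩ := W.ne_bot_iff.1 hW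
    refine (Submodule.ne_bot_iff _).2 ⟨S y, ⟨h.mem' y, ?_⟩, fun h0 => hy0 ?_⟩
    · change T (S y) ∈ W
      rwa [h.right_inv y (hWN hy)]
    · rw [← h.right_inv y (hWN hy), h0, _root_.map_zero]
  · change T (S y) ∈ W
    rwa [h.right_inv y (hWN hy)]

/-- For `y = T x` with `x` in `Nᗮ`, `‖S y‖ / ‖y‖ = ‖x‖ / ‖T x‖`: a minimizer of `T` on the preimage
of `W` has a normalized image maximizing `S`. -/
theorem normAttaining (h : InverseOnOrthogonal N T S) (hT : AbsolutelyMinimumAttaining T)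
    {W : Submodule ℂ H} (hWc : IsClosed (W : Set H)) (hWN : W ≤ Nᗮ) (hW : W ≠ ⊥) :
    NormAttaining (S ∘L W.subtypeL) := by
  obtain ⟨W', hc, hne, hW', hS⟩ := h.exists_preimage hWc hWN hW
  obtain ⟨x, hx, hx1, hmin⟩ := (minimumAttaining_comp_subtypeL_iff _ _).1 (hT W' hc hne)
  have hTx : 0 < ‖T x‖ := norm_pos_iff.2 fun h0 => by
    have := h.left_inv x (hW' x hx).1
    rw [h0, _root_.map_zero] at this
    rw [← this, norm_zero] at hx1
    exact zero_ne_one hx1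
  have hn : ‖S ((‖T x‖⁻¹ : ℂ) • T x)‖ = ‖T x‖⁻¹ := by
    rw [map_smul, h.left_inv x (hW' x hx).1, norm_smul, hx1]
    simp
  refine (normAttaining_comp_subtypeL_iff _ _).2
    ⟨(‖T x‖⁻¹ : ℂ) • T x, W.smul_mem _ (hW' x hx).2, ?_, fun z hz => ?_⟩
  · rw [norm_smul]
    simp [hTx.ne']
  · rw [hn, inv_mul_eq_div, le_div_iff₀' hTx]
    simpa only [h.right_inv z (hWN hz)] using hmin _ (hS z hz)

theorem minimumAttaining (h : InverseOnOrthogonal N T S) (hT : AbsolutelyNormAttaining T)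
    {W : Submodule ℂ H} (hWc : IsClosed (W : Set H)) (hWN : W ≤ Nᗮ) (hW : W ≠ ⊥) :
    MinimumAttaining (S ∘L W.subtypeL) := by
  obtain ⟨W', hc, hne, hW', hS⟩ := h.exists_preimage hWc hWN hW
  obtain ⟨x, hx, hx1, hmax⟩ := (normAttaining_comp_subtypeL_iff _ _).1 (hT W' hc hne)
  have hTx : 0 < ‖T x‖ := norm_pos_iff.2 fun h0 => by
    have := h.left_inv x (hW' x hx).1
    rw [h0, _root_.map_zero] at this
    rw [← this, norm_zero] at hx1
    exact zero_ne_one hx1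
  have hn : ‖S ((‖T x‖⁻¹ : ℂ) • T x)‖ = ‖T x‖⁻¹ := by
    rw [map_smul, h.left_inv x (hW' x hx).1, norm_smul, hx1]
    simp
  refine (minimumAttaining_comp_subtypeL_iff _ _).2
    ⟨(‖T x‖⁻¹ : ℂ) • T x, W.smul_mem _ (hW' x hx).2, ?_, fun z hz => ?_⟩
  · rw [norm_smul]
    simp [hTx.ne']
  · rw [hn, inv_mul_eq_div, div_le_iff₀' hTx]
    simpa only [h.right_inv z (hWN hz)] using hmax _ (hS z hz)

theorem absolutelyNormAttaining [CompleteSpace H] (h : InverseOnOrthogonal N T S) (hN : IsClosed (N : Set H))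
    (hT : AbsolutelyMinimumAttaining T) : AbsolutelyNormAttaining S := by
  have : CompleteSpace N := hN.completeSpace_coe
  intro M hM hM0
  rcases hT.finiteDimensional_or h.map_zero (fun x hx h0 => by
    rw [← h.left_inv x hx, h0, _root_.map_zero]) with hfin | hfin
  · exact NormAttaining.of_inf_orthogonal hM hM0 (D := N) fun h0 =>
      h.normAttaining hT (hM.inter N.isClosed_orthogonal) inf_le_right h0
  -- What remains is `M ⊓ N`, where `S` vanishes and any unit vector serves.
  · refine NormAttaining.of_inf_orthogonal hM hM0 (D := Nᗮ) fun h0 => ?_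
    obtain ⟨x, hx, hx1⟩ := exists_mem_norm_eq_one h0
    rw [N.orthogonal_orthogonal] at hx ⊢
    refine (normAttaining_comp_subtypeL_iff _ _).2 ⟨x, hx, hx1, fun z hz => ?_⟩
    rw [h.map_zero' z hz.2, norm_zero]
    positivity

theorem absolutelyMinimumAttaining [CompleteSpace H] (h : InverseOnOrthogonal N T S) (hN : IsClosed (N : Set H))
    (hS : AbsolutelyNormAttaining S) : AbsolutelyMinimumAttaining T := by
  have : CompleteSpace N := hN.completeSpace_coe
  intro M hM hM0
  -- From `‖x‖ = ‖T (S x)‖ ≤ ‖T‖‖S x‖`; the `+ 1` keeps the constant positive when `T = 0`.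
  have hbelow : ∀ x ∈ Nᗮ, (‖T‖ + 1)⁻¹ * ‖x‖ ≤ ‖S x‖ := fun x hx => by
    rw [inv_mul_eq_div, div_le_iff₀' (by positivity)]
    have h1 := T.le_opNorm (S x)
    rw [h.right_inv x hx] at h1
    nlinarith [norm_nonneg (S x)]
  rcases hS.finiteDimensional_or h.map_zero' (by positivity) hbelow with hfin | hfin
  · exact MinimumAttaining.of_inf_orthogonal hM hM0 (D := N) fun h0 =>
      h.symm.minimumAttaining hS (hM.inter N.isClosed_orthogonal) inf_le_right h0
  · refine MinimumAttaining.of_inf_orthogonal hM hM0 (D := Nᗮ) fun h0 => ?_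
    obtain ⟨x, hx, hx1⟩ := exists_mem_norm_eq_one h0
    rw [N.orthogonal_orthogonal] at hx ⊢
    refine (minimumAttaining_comp_subtypeL_iff _ _).2 ⟨x, hx, hx1, fun z hz => ?_⟩
    simp [h.map_zero x hx.2]

end InverseOnOrthogonal

/-- The minimum over unit vectors of `N(T)ᗮ` is attained, hence nonzero by injectivity there. -/
theorem AbsolutelyMinimumAttaining.exists_bound_below {T : H →L[ℂ] H}
    (hT : AbsolutelyMinimumAttaining T) :
    ∃ c > 0, ∀ x ∈ (nullSpace T)ᗮ, c * ‖x‖ ≤ ‖T x‖ := by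
  rcases eq_or_ne (nullSpace T)ᗮ ⊥ with h0 | h0
  · refine ⟨1, one_pos, fun x hx => ?_⟩
    rw [h0, Submodule.mem_bot] at hx
    simp [hx]
  obtain ⟨x, hx, hx1, hmin⟩ := (minimumAttaining_comp_subtypeL_iff _ _).1
    (hT _ (Submodule.isClosed_orthogonal _) h0)
  refine ⟨‖T x‖, norm_pos_iff.2 fun hTx => ?_, hmin⟩
  rw [eq_zero_of_mem_orthogonal_nullSpace hx hTx, norm_zero] at hx1
  exact zero_ne_one hx1

theorem isClosed_range_of_bound_below [CompleteSpace H] {T : H →L[ℂ] H} {c : ℝ} (hc : 0 < c)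
    (hbelow : ∀ x ∈ (nullSpace T)ᗮ, c * ‖x‖ ≤ ‖T x‖) : IsClosed (range T : Set H) := by
  have : CompleteSpace (nullSpace T) := T.isClosed_ker.completeSpace_coe
  set A := T ∘L (nullSpace T)ᗮ.subtypeL with hA
  have hanti : AntilipschitzWith (Real.toNNReal c⁻¹) A := by
    refine ContinuousLinearMap.antilipschitz_of_bound A fun x => ?_
    rw [Real.coe_toNNReal _ (inv_nonneg.2 hc.le), inv_mul_eq_div, le_div_iff₀' hc]
    exact hbelow x x.2
  have hset : (range T : Set H) = Set.range A := by
    ext y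
    constructor
    · rintro ⟨x, rfl⟩
      obtain ⟨p, hp, q, hq, rfl⟩ := (nullSpace T).exists_add_mem_mem_orthogonal x
      have hp' : T p = 0 := hp
      exact ⟨⟨q, hq⟩, by simp [hA, hp']⟩
    · rintro ⟨x, rfl⟩
      exact ⟨x, rfl⟩
  rw [hset]
  exact hanti.isClosed_range A.uniformContinuous

end Transfer

end HilbertOperator

theorem theorem4p3 {H : Type*} [NormedAddCommGroup H] [InnerProductSpace ℂ H] [CompleteSpace H]
    (T : H →L[ℂ] H)
    (hT : HilbertOperator.nullSpace T = HilbertOperator.nullSpace (ContinuousLinearMap.adjoint T)) :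
    (HilbertOperator.Paranormal T ↔
      HilbertOperator.ParanormalPMap (HilbertOperator.moorePenrose T)) ∧
    (HilbertOperator.AbsolutelyMinimumAttaining T ↔
      IsClosed (HilbertOperator.range T : Set H) ∧
        ∃ S : H →L[ℂ] H, HilbertOperator.toPMap S = HilbertOperator.moorePenrose T ∧
          HilbertOperator.AbsolutelyNormAttaining S) := by
  refine ⟨HilbertOperator.paranormal_iff_paranormalPMap_moorePenrose hT, fun h => ?_, ?_⟩
  · obtain ⟨c, hc, hbelow⟩ := h.exists_bound_below
    have hR := HilbertOperator.isClosed_range_of_bound_below hc hbelow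
    obtain ⟨S, hS⟩ := HilbertOperator.exists_toPMap_eq_moorePenrose hR hc hbelow
    exact ⟨hR, S, hS, (HilbertOperator.InverseOnOrthogonal.of_moorePenrose hT
      hS).absolutelyNormAttaining T.isClosed_ker h⟩
  · rintro ⟨-, S, hS, hSA⟩
    exact (HilbertOperator.InverseOnOrthogonal.of_moorePenrose hT
      hS).absolutelyMinimumAttaining T.isClosed_ker hSA
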